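/- An abstract storage device (ASD) $D$ consists of a finite set $\mathcal S(D)$ of states and a set $\Pi(D)$ of partitions of $\mathcal S(D)$. For a partition $\pi$ of a set $T$ and a map $\phi: S\to T$, let $\pi\circ\phi$ be the partition of $S$ in which $x,y$ lie in the same block iff $\phi(x),\phi(y)$ lie in the same block of $\pi$. Write $D\le D'$ if there are functions $\phi:\mathcal S(D)\to\mathcal S(D')$ and $\alpha:\Pi(D)\to\Pi(D')$ such that $\alpha(\pi)\circ\phi$ refines $\pi$ for all $\pi\in\Pi(D)$, and call $D,D'$ equivalent if $D\le D'$ and $D'\le D$. The direct product of $D_1,\dots,D_m$ has state set $\prod_i\mathcal S(D_i)$ and as partitions all products $\pi_1\times\cdots\times\pi_m$ with $\pi_i\in\Pi(D_i)$, where two tuples lie in the same block of $\pi_1\times\cdots\times\pi_m$ iff for each $i$ their $i$-th entries lie in the same block of $\pi_i$ (the empty product is the one-state device with its only partition). For $n\ge 1$, the binary linear device $L_n$ has state set $\{0,1\}^n$, and its partitions are the kernel partitions $\{f^{-1}(y)\}_{y\in\operatorname{range} f}$ of all $\mathrm{GF}(2)$-linear maps $f:\{0,1\}^n\to\{0,1\}$.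 **Corollary.** Let $m,n\ge 0$ and let $k_1,\dots,k_m,r_1,\dots,r_n\ge 1$ be integers. Then the direct products $L_{k_1}\times\cdots\times L_{k_m}$ and $L_{r_1}\times\cdots\times L_{r_n}$ are equivalent if and only if the multisets of devices $\{L_{k_1},\dots,L_{k_m}\}$ and $\{L_{r_1},\dots,L_{r_n}\}$ coincide, i.e. the two products consist of the same devices with the same multiplicities. -/

import Mathlib

/-- An abstract storage device: a finite set of states together with a set of partitions of the
states. Partitions are encoded as equivalence relations (`Setoid`), so that `π ≤ ρ` says that `π`
refines `ρ`, `Setoid.comap φ π` is the pullback partition `π ∘ φ`, and `Setoid.ker f` is the kernel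
partition of `f`. The partition set is automatically finite. -/
structure ASD : Type 1 where
  State : Type
  finite_state : Finite State
  parts : Set (Setoid State)

namespace ASD

/-- `D ≤ D'`: there are `φ` on states and `α` on partitions such that `α(π) ∘ φ` refines `π` for
every partition `π` of `D`. -/
def ReducibleTo (D D' : ASD) : Prop :=
  ∃ (φ : D.State → D'.State) (α : D.parts → D'.parts),
    ∀ π : D.parts, Setoid.comap φ (α π).1 ≤ π.1

/-- Two devices are equivalent when each is reducible to the other. -/
def Equivalent (D D' : ASD) : Prop :=
  D.ReducibleTo D' ∧ D'.ReducibleTo D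

/-- The direct product of two devices. -/
def prod (D D' : ASD) : ASD where
  State := D.State × D'.State
  finite_state := by
    have := D.finite_state
    have := D'.finite_state
    infer_instance
  parts := {ρ | ∃ π ∈ D.parts, ∃ π' ∈ D'.parts, ρ = Setoid.prod π π'}

/-- The direct product of a finite family of devices: the states are the tuples of states, and the
partitions are the products of partitions, one chosen from each factor (two tuples are in the same
block iff they are so in every coordinate). The empty product is the trivial one-state device. -/
def directProduct {ι : Type} [Finite ι] (D : ι → ASD) : ASD where
  State := ∀ i, (D i).State
  finite_state := by
    have := fun i => (D i).finite_state
    infer_instance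
  parts := {ρ | ∃ π : ∀ i, Setoid (D i).State, (∀ i, π i ∈ (D i).parts) ∧
    ∀ s t, ρ s t ↔ ∀ i, π i (s i) (t i)}

/-- The linear device `L_{n,k}`: the states are the binary vectors of length `n`, the partitions are
the kernel partitions of all `GF(2)`-linear maps `{0,1}ⁿ → {0,1}ᵏ`. -/
def linearDevice (n k : ℕ) : ASD where
  State := Fin n → ZMod 2
  finite_state := inferInstance
  parts := Set.range fun f : (Fin n → ZMod 2) →ₗ[ZMod 2] (Fin k → ZMod 2) => Setoid.ker f

/-- The binary linear device `L_n = L_{n,1}` (of interest for `n ≥ 1`). -/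
def L (n : ℕ) : ASD := linearDevice n 1

/-- Devices `L_n` with different parameters are different. -/
theorem L_injective : Function.Injective L := by
  intro m n h
  have h1 : Nat.card (L m).State = Nat.card (L n).State := by rw [h]
  have h2 : ∀ n, Nat.card (L n).State = 2 ^ n := by
    intro n
    show Nat.card (Fin n → ZMod 2) = 2 ^ n
    simp [Nat.card_eq_fintype_card, ZMod.card]
  rw [h2, h2] at h1
  exact Nat.pow_right_injective le_rfl h1

/-- The direct product of a family agrees, up to equivalence, with the iterated binary one. -/
theorem directProduct_succ {n : ℕ} (D : Fin (n + 1) → ASD) :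
    (directProduct D).Equivalent ((D 0).prod (directProduct fun i : Fin n => D i.succ)) := by
  constructor
  · have key : ∀ ρ : (directProduct D).parts, ∃ σ : ((D 0).prod
        (directProduct fun i : Fin n => D i.succ)).parts,
        Setoid.comap (fun s : (directProduct D).State => (s 0, fun i : Fin n => s i.succ)) σ.1
          ≤ ρ.1 := by
      rintro ⟨ρ, π, hπ, hρ⟩
      refine ⟨⟨Setoid.prod (π 0) ⟨fun s t => ∀ i : Fin n, π i.succ (s i) (t i), ⟨?_, ?_, ?_⟩⟩,
        π 0, hπ 0, _, ⟨fun i => π i.succ, fun i => hπ _, fun s t => Iff.rfl⟩, rfl⟩, ?_⟩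
      · exact fun s i => (π i.succ).refl _
      · exact fun h i => (π i.succ).symm (h i)
      · exact fun h h' i => (π i.succ).trans (h i) (h' i)
      · intro s t h
        exact (hρ s t).2 (Fin.cases h.1 h.2)
    choose α hα using key
    exact ⟨_, α, hα⟩
  · have key : ∀ σ : ((D 0).prod (directProduct fun i : Fin n => D i.succ)).parts,
        ∃ ρ : (directProduct D).parts,
        Setoid.comap (fun s : (D 0).State × (∀ i : Fin n, (D i.succ).State) =>
          (Fin.cons s.1 s.2 : ∀ i, (D i).State)) ρ.1 ≤ σ.1 := by
      rintro ⟨_, π, hπ, σ, ⟨τ, hτ, hσ⟩, rfl⟩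
      let p : ∀ i, Setoid (D i).State := Fin.cons π τ
      refine ⟨⟨⟨fun s t => ∀ i, p i (s i) (t i), ⟨?_, ?_, ?_⟩⟩, p, Fin.cases hπ hτ,
        fun s t => Iff.rfl⟩, ?_⟩
      · exact fun s i => (p i).refl _
      · exact fun h i => (p i).symm (h i)
      · exact fun h h' i => (p i).trans (h i) (h' i)
      · intro s t h
        exact ⟨h 0, (hσ _ _).2 fun i => h i.succ⟩
    choose α hα using key
    exact ⟨_, α, hα⟩

end ASD

/-!
Call a device binary if its partitions have at most two blocks. A two-block partition is a coatom of
the partition lattice, so two distinct ones have join `⊤`; as products of partitions commute with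
joins, the join of two products of two-block partitions has `2 ^ a` blocks, where `a` is the number
of coordinates in which the two products agree.

Counting blocks, equivalent products of binary devices have equally many factors, and a reduction
assigns to each product `∏ πᵢ` of two-block partitions a product `A π` of the same kind whose
pullback is exactly `∏ πᵢ`. Every block of `A π` then meets the image of the map on states, so
pulling back does not decrease the number of blocks of a join with `A π`, and `A` cannot increase
agreement. In particular `A` is injective, and so bijective, as there is such a map in the other
direction too. If the `i`-th factor has `aᵢ` two-block partitions, then for fixed `π` the sum of
`(t + 1) ^ agreement π ρ` over all `ρ` equals `∏ (t + aᵢ)`. Hence the polynomials `∏ (t + aᵢ)` of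
the two products coincide, and so do the multisets of their roots. Finally, `L_k` has `2 ^ k - 1`
two-block partitions, which determines `k`.
-/

namespace ASD

section Families

variable {ι κ : Type*} [Fintype ι] [Fintype κ]

theorem exists_equiv_of_map_univ_eq {α : Type*} {f : ι → α} {g : κ → α}
    (h : Finset.univ.val.map f = Finset.univ.val.map g) :
    ∃ e : κ ≃ ι, ∀ j, f (e j) = g j := by
  classical
  have hfiber (c : α) : Fintype.card {j // g j = c} = Fintype.card {i // f i = c} := by
    rw [Fintype.card_subtype, Fintype.card_subtype]
    simpa only [Multiset.count_map, eq_comm, Finset.card_def, Finset.filter_val] using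
      congrArg (Multiset.count c) h.symm
  exact ⟨Equiv.ofFiberEquiv fun c => Fintype.equivOfCardEq (hfiber c), Equiv.ofFiberEquiv_map _⟩

theorem prod_eq_pow_card_iff_of_le {f : ι → ℕ} {c : ℕ} (hc : 0 < c) (hf : ∀ i, f i ≤ c) :
    ∏ i, f i = c ^ Fintype.card ι ↔ ∀ i, f i = c := by
  classical
  refine ⟨fun h i => le_antisymm (hf i) ?_, fun h => Finset.prod_eq_pow_card fun i _ => h i⟩
  have hle : c * ∏ _ ∈ Finset.univ.erase i, c ≤ f i * ∏ _ ∈ Finset.univ.erase i, c :=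
    calc c * ∏ _ ∈ Finset.univ.erase i, c = c ^ Fintype.card ι := by
          rw [Finset.mul_prod_erase _ (fun _ => c) (Finset.mem_univ i), Finset.prod_const,
            Finset.card_univ]
      _ = f i * ∏ j ∈ Finset.univ.erase i, f j := by
          rw [← h, Finset.mul_prod_erase _ _ (Finset.mem_univ i)]
      _ ≤ f i * ∏ _ ∈ Finset.univ.erase i, c := by gcongr; exact hf _
  exact le_of_mul_le_mul_right hle (Finset.prod_pos fun _ _ => hc)

open Polynomial

theorem roots_prod_X_add_C_natCast (a : ι → ℕ) :
    (∏ i, (X + C (a i : ℤ))).roots = Finset.univ.val.map fun i => -(a i : ℤ) := by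
  rw [← roots_multiset_prod_X_sub_C (Finset.univ.val.map fun i => -(a i : ℤ)), Multiset.map_map]
  simp only [Function.comp_def, C_neg, sub_neg_eq_add, Finset.prod_map_val]

theorem map_univ_eq_of_prod_add_eq {a : ι → ℕ} {b : κ → ℕ}
    (h : ∀ t : ℕ, ∏ i, (t + a i) = ∏ j, (t + b j)) :
    Finset.univ.val.map a = Finset.univ.val.map b := by
  have hpoly : ∏ i, (X + C (a i : ℤ)) = ∏ j, (X + C (b j : ℤ)) := by
    refine eq_of_infinite_eval_eq _ _
      ((Set.infinite_range_of_injective Nat.cast_injective).mono ?_)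
    rintro _ ⟨t, rfl⟩
    simp only [Set.mem_ofPred_eq, eval_prod, eval_add, eval_X, eval_C]
    exact_mod_cast h t
  have hroots := congrArg (Multiset.map fun z : ℤ => (-z).toNat) (congrArg roots hpoly)
  simpa only [roots_prod_X_add_C_natCast, Multiset.map_map, Function.comp_def, neg_neg,
    Int.toNat_natCast] using hroots

end Families

/-! ### Partitions and their blocks -/

section Partitions

variable {S T : Type*}

/-- The number of blocks of a partition, by which partitions are compared below; it is `0` if there
are infinitely many blocks. -/
noncomputable def numBlocks (π : Setoid S) : ℕ := Nat.card (Quotient π)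

theorem map_of_le_surjective {π ρ : Setoid S} (h : π ≤ ρ) :
    Function.Surjective (Setoid.map_of_le h) := by
  rintro ⟨s⟩
  exact ⟨Quotient.mk π s, rfl⟩

theorem numBlocks_anti [Finite S] {π ρ : Setoid S} (h : π ≤ ρ) : numBlocks ρ ≤ numBlocks π :=
  Nat.card_le_card_of_surjective _ (map_of_le_surjective h)

theorem eq_of_le_of_numBlocks_le [Finite S] {π ρ : Setoid S} (h : π ≤ ρ)
    (hcard : numBlocks π ≤ numBlocks ρ) : π = ρ := by
  have hinj : Function.Injective (Setoid.map_of_le h) :=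
    ((map_of_le_surjective h).bijective_of_nat_card_le hcard).injective
  exact le_antisymm h fun s t hst => Quotient.exact (hinj (Quotient.sound (s := ρ) hst))

theorem numBlocks_le_one_iff [Finite S] {π : Setoid S} : numBlocks π ≤ 1 ↔ π = ⊤ := by
  rw [numBlocks, Finite.card_le_one_iff_subsingleton, Quotient.subsingleton_iff]

theorem numBlocks_ker_le [Finite T] (f : S → T) : numBlocks (Setoid.ker f) ≤ Nat.card T :=
  Nat.card_le_card_of_injective _ (Setoid.kerLift_injective f)

theorem isCoatom_of_numBlocks_eq_two [Finite S] {π : Setoid S} (h : numBlocks π = 2) :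
    IsCoatom π := by
  refine ⟨fun htop => ?_, fun ρ hρ => ?_⟩
  · have := numBlocks_le_one_iff.2 htop
    omega
  · by_contra hne
    have : ¬ numBlocks ρ ≤ 1 := mt numBlocks_le_one_iff.1 hne
    exact hρ.ne (eq_of_le_of_numBlocks_le hρ.le (by omega))

open Classical in
theorem numBlocks_sup_of_eq_two [Finite S] {π ρ : Setoid S} (hπ : numBlocks π = 2)
    (hρ : numBlocks ρ = 2) : numBlocks (π ⊔ ρ) = if π = ρ then 2 else 1 := by
  split_ifs with h
  · rw [h, sup_idem, hρ]
  · rw [(isCoatom_of_numBlocks_eq_two hπ).sup_eq_top_of_ne (isCoatom_of_numBlocks_eq_two hρ) h]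
    have : Nonempty (Quotient π) := (Nat.card_pos_iff.1 (two_pos.trans_eq hπ.symm)).1
    have : Nonempty (Quotient (⊤ : Setoid S)) := this.map (Setoid.map_of_le le_top)
    exact le_antisymm (numBlocks_le_one_iff.2 rfl) Nat.card_pos

/-- The map induced by `φ` from the blocks of the pullback `ρ ∘ φ` to those of `ρ`, used to compare
their numbers. -/
def comapBlocks (φ : S → T) (ρ : Setoid T) : Quotient (Setoid.comap φ ρ) → Quotient ρ :=
  Quotient.map φ fun _ _ h => h

theorem comapBlocks_injective (φ : S → T) (ρ : Setoid T) :
    Function.Injective (comapBlocks φ ρ) := by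
  rintro ⟨s⟩ ⟨t⟩ h
  exact Quotient.sound (Quotient.exact (s := ρ) h)

theorem numBlocks_comap_le [Finite T] (φ : S → T) (ρ : Setoid T) :
    numBlocks (Setoid.comap φ ρ) ≤ numBlocks ρ :=
  Nat.card_le_card_of_injective _ (comapBlocks_injective φ ρ)

theorem numBlocks_le_of_comap_le [Finite S] [Finite T] {φ : S → T} {π : Setoid S} {ρ : Setoid T}
    (h : Setoid.comap φ ρ ≤ π) : numBlocks π ≤ numBlocks ρ :=
  (numBlocks_anti h).trans (numBlocks_comap_le φ ρ)

theorem comap_eq_of_comap_le [Finite S] [Finite T] {φ : S → T} {π : Setoid S} {ρ : Setoid T}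
    (h : Setoid.comap φ ρ ≤ π) (hcard : numBlocks ρ ≤ numBlocks π) : Setoid.comap φ ρ = π :=
  eq_of_le_of_numBlocks_le h ((numBlocks_comap_le φ ρ).trans hcard)

theorem exists_rel_of_numBlocks_le_comap [Finite T] {φ : S → T} {ρ : Setoid T}
    (h : numBlocks ρ ≤ numBlocks (Setoid.comap φ ρ)) (t : T) : ∃ s, ρ (φ s) t := by
  obtain ⟨⟨s⟩, hs⟩ :=
    ((comapBlocks_injective φ ρ).bijective_of_nat_card_le h).surjective (Quotient.mk ρ t)
  exact ⟨s, Quotient.exact hs⟩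

theorem numBlocks_sup_le_of_numBlocks_le_comap [Finite S] [Finite T] {φ : S → T} {ρ σ : Setoid T}
    (h : numBlocks ρ ≤ numBlocks (Setoid.comap φ ρ)) :
    numBlocks (ρ ⊔ σ) ≤ numBlocks (Setoid.comap φ ρ ⊔ Setoid.comap φ σ) := by
  have hle : Setoid.comap φ ρ ⊔ Setoid.comap φ σ ≤ Setoid.comap φ (ρ ⊔ σ) :=
    sup_le (fun _ _ hst => (le_sup_left : ρ ≤ ρ ⊔ σ) hst)
      fun _ _ hst => (le_sup_right : σ ≤ ρ ⊔ σ) hst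
  refine Nat.card_le_card_of_surjective (comapBlocks φ (ρ ⊔ σ) ∘ Setoid.map_of_le hle) ?_
  rintro ⟨t⟩
  obtain ⟨s, hs⟩ := exists_rel_of_numBlocks_le_comap h t
  exact ⟨Quotient.mk _ s, Quotient.sound ((le_sup_left : ρ ≤ ρ ⊔ σ) hs)⟩

end Partitions

section ProductPartition

variable {ι : Type*} {S : ι → Type*}

/-- The product partition `π₁ × ⋯ × πₘ`: two tuples lie in the same block iff they do so in every
coordinate. -/
abbrev prodPartition (π : ∀ i, Setoid (S i)) : Setoid (∀ i, S i) := @piSetoid ι S π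

theorem prodPartition_le_of_update [Finite ι] [DecidableEq ι] {π : ∀ i, Setoid (S i)}
    {ρ : Setoid (∀ i, S i)}
    (h : ∀ s i a, π i (s i) a → ρ s (Function.update s i a)) : prodPartition π ≤ ρ := by
  have := Fintype.ofFinite ι
  intro s t hst
  have hpiecewise : ∀ I : Finset ι, ρ s (I.piecewise t s) := by
    intro I
    induction I using Finset.induction_on with
    | empty => simpa only [Finset.piecewise_empty] using ρ.refl' s
    | insert i I hi ih =>
      rw [Finset.piecewise_insert]
      refine ρ.trans' ih (h _ i _ ?_)
      rw [Finset.piecewise_eq_of_notMem I t s hi]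
      exact hst i
  simpa only [Finset.piecewise_univ] using hpiecewise Finset.univ

theorem prodPartition_sup [Finite ι] (π ρ : ∀ i, Setoid (S i)) :
    prodPartition π ⊔ prodPartition ρ = prodPartition fun i => π i ⊔ ρ i := by
  classical
  refine le_antisymm (sup_le ?_ ?_) (prodPartition_le_of_update fun s i a hsa => ?_)
  · exact fun s t hst i => (le_sup_left : π i ≤ π i ⊔ ρ i) (hst i)
  · exact fun s t hst i => (le_sup_right : ρ i ≤ π i ⊔ ρ i) (hst i)
  · have update_rel (τ : ∀ i, Setoid (S i)) :
        τ i ≤ Setoid.comap (Function.update s i) (prodPartition τ) := by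
      intro a b hab j
      obtain rfl | hj := eq_or_ne j i
      · simpa only [Function.update_self] using hab
      · simpa only [Function.update_of_ne hj] using (τ j).refl' (s j)
    have hle : π i ⊔ ρ i ≤
        Setoid.comap (Function.update s i) (prodPartition π ⊔ prodPartition ρ) :=
      sup_le (fun _ _ hab => (le_sup_left : prodPartition π ≤ _) (update_rel π hab))
        fun _ _ hab => (le_sup_right : prodPartition ρ ≤ _) (update_rel ρ hab)
    simpa only [Setoid.comap_rel, Function.update_eq_self] using hle hsa

end ProductPartition

/-! ### Agreement of tuples -/

section Agreement

variable {ι κ : Type*} [Fintype ι] [Fintype κ]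
  {X : ι → Type*} {Y : κ → Type*}

open Classical in
/-- The number of coordinates in which two tuples agree, i.e. the number of coordinates minus the
Hamming distance. -/
noncomputable def agreement (x y : ∀ i, X i) : ℕ := Finset.card {i | x i = y i}

theorem card_le_agreement_iff {x y : ∀ i, X i} : Fintype.card ι ≤ agreement x y ↔ x = y := by
  classical
  rw [agreement, ← Finset.card_univ, (Finset.card_filter_le _ _).ge_iff_eq,
    Finset.card_filter_eq_iff, funext_iff]
  simp only [Finset.mem_univ, forall_const]

theorem agreement_coe {α : ι → Type*} {P : ∀ i, Set (α i)} (x y : ∀ i, P i) :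
    agreement (fun i => (x i : α i)) (fun i => (y i : α i)) = agreement x y := by
  rw [agreement, agreement]
  congr! 3
  exact Subtype.ext_iff.symm

theorem injective_of_agreement_le (hcard : Fintype.card ι ≤ Fintype.card κ)
    {A : (∀ i, X i) → ∀ j, Y j} (hA : ∀ x y, agreement (A x) (A y) ≤ agreement x y) :
    Function.Injective A := fun x y hxy =>
  card_le_agreement_iff.1 <| hcard.trans <| (card_le_agreement_iff.2 hxy).trans (hA x y)

open Classical in
theorem sum_pow_agreement [∀ i, Fintype (X i)] (x : ∀ i, X i) (t : ℕ) :
    ∑ y, (t + 1) ^ agreement x y = ∏ i, (t + Fintype.card (X i)) := by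
  have hfactor (i : ι) : ∑ a : X i, (if x i = a then t + 1 else 1) = t + Fintype.card (X i) := by
    have hsplit (a : X i) : (if x i = a then t + 1 else 1) = (if x i = a then t else 0) + 1 := by
      split_ifs <;> rfl
    simp only [hsplit, Finset.sum_add_distrib, Finset.sum_ite_eq, Finset.mem_univ, if_true,
      Finset.sum_const, Finset.card_univ, smul_eq_mul, mul_one]
  simp only [← hfactor, Fintype.prod_sum, agreement, Finset.prod_ite, Finset.prod_const,
    one_pow, mul_one]

theorem prod_add_card_le_of_agreement_le [∀ i, Fintype (X i)] [∀ j, Fintype (Y j)]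
    [∀ i, Nonempty (X i)] {A : (∀ i, X i) → ∀ j, Y j} (hbij : Function.Bijective A)
    (hA : ∀ x y, agreement (A x) (A y) ≤ agreement x y) (t : ℕ) :
    ∏ j, (t + Fintype.card (Y j)) ≤ ∏ i, (t + Fintype.card (X i)) := by
  classical
  obtain ⟨x⟩ : Nonempty (∀ i, X i) := inferInstance
  rw [← sum_pow_agreement x, ← sum_pow_agreement (A x), ← hbij.sum_comp]
  exact Finset.sum_le_sum fun y _ => Nat.pow_le_pow_right t.succ_pos (hA x y)

theorem map_card_eq_of_agreement_le [∀ i, Finite (X i)] [∀ j, Finite (Y j)]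
    [∀ i, Nonempty (X i)] [∀ j, Nonempty (Y j)] (hcard : Fintype.card ι = Fintype.card κ)
    {A : (∀ i, X i) → ∀ j, Y j} (hA : ∀ x y, agreement (A x) (A y) ≤ agreement x y)
    {B : (∀ j, Y j) → ∀ i, X i} (hB : ∀ x y, agreement (B x) (B y) ≤ agreement x y) :
    Finset.univ.val.map (fun i => Nat.card (X i)) =
      Finset.univ.val.map (fun j => Nat.card (Y j)) := by
  classical
  have := fun i => Fintype.ofFinite (X i)
  have := fun j => Fintype.ofFinite (Y j)
  have hAinj := injective_of_agreement_le hcard.le hA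
  have hBinj := injective_of_agreement_le hcard.ge hB
  have hAbij := hAinj.bijective_of_nat_card_le (Nat.card_le_card_of_injective B hBinj)
  have hBbij := hBinj.bijective_of_nat_card_le (Nat.card_le_card_of_injective A hAinj)
  simp only [Nat.card_eq_fintype_card]
  exact map_univ_eq_of_prod_add_eq fun t => le_antisymm
    (prod_add_card_le_of_agreement_le hBbij hB t) (prod_add_card_le_of_agreement_le hAbij hA t)

end Agreement

section TwoBlocks

variable {ι : Type*} [Fintype ι] {S : ι → Type*}

theorem numBlocks_prodPartition (π : ∀ i, Setoid (S i)) :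
    numBlocks (prodPartition π) = ∏ i, numBlocks (π i) := by
  rw [numBlocks, ← Nat.card_congr (Setoid.piQuotientEquiv π), Nat.card_pi]
  rfl

theorem numBlocks_prodPartition_le {π : ∀ i, Setoid (S i)} (hπ : ∀ i, numBlocks (π i) ≤ 2) :
    numBlocks (prodPartition π) ≤ 2 ^ Fintype.card ι := by
  rw [numBlocks_prodPartition]
  exact Finset.prod_le_pow_card _ _ _ fun i _ => hπ i

theorem numBlocks_prodPartition_eq_two_pow_iff {π : ∀ i, Setoid (S i)}
    (hπ : ∀ i, numBlocks (π i) ≤ 2) :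
    numBlocks (prodPartition π) = 2 ^ Fintype.card ι ↔ ∀ i, numBlocks (π i) = 2 := by
  rw [numBlocks_prodPartition, prod_eq_pow_card_iff_of_le two_pos hπ]

theorem numBlocks_prodPartition_sup [∀ i, Finite (S i)] {π ρ : ∀ i, Setoid (S i)}
    (hπ : ∀ i, numBlocks (π i) = 2) (hρ : ∀ i, numBlocks (ρ i) = 2) :
    numBlocks (prodPartition π ⊔ prodPartition ρ) = 2 ^ agreement π ρ := by
  simp only [prodPartition_sup, numBlocks_prodPartition, numBlocks_sup_of_eq_two (hπ _) (hρ _),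
    Finset.prod_ite, Finset.prod_const, one_pow, mul_one, agreement]

end TwoBlocks

/-! ### Products of binary devices -/

section BinaryDevices

instance (D : ASD) : Finite D.State := D.finite_state

/-- A device is binary if each of its partitions has at most two blocks, i.e. reveals at most one
bit about the state. -/
def IsBinary (D : ASD) : Prop := ∀ π ∈ D.parts, numBlocks π ≤ 2

/-- The partitions of a device other than the one-block partition `⊤`; for a binary device these are
its partitions into exactly two blocks. -/
def nontrivialParts (D : ASD) : Set (Setoid D.State) := D.parts \ {⊤}

instance (D : ASD) : Finite D.nontrivialParts :=
  have : Finite (Setoid D.State) :=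
    Finite.of_injective (fun π => ⇑π) fun _ _ => Setoid.eq_iff_rel_eq.2
  inferInstance

theorem IsBinary.mem_nontrivialParts_iff {D : ASD} (hD : D.IsBinary) {π : Setoid D.State} :
    π ∈ D.nontrivialParts ↔ π ∈ D.parts ∧ numBlocks π = 2 := by
  refine and_congr_right fun hπ => ?_
  have hle : numBlocks π ≤ 2 := hD π hπ
  rw [Set.mem_singleton_iff, ← numBlocks_le_one_iff]
  omega

theorem mem_parts_directProduct {ι : Type} [Finite ι] {D : ι → ASD}
    {ρ : Setoid (∀ i, (D i).State)} :
    ρ ∈ (directProduct D).parts ↔ ∃ π : ∀ i, (D i).parts, prodPartition (fun i => (π i).1) = ρ := by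
  constructor
  · rintro ⟨π, hπ, hρ⟩
    exact ⟨fun i => ⟨π i, hπ i⟩, Setoid.ext fun s t => (hρ s t).symm⟩
  · rintro ⟨π, rfl⟩
    exact ⟨fun i => (π i).1, fun i => (π i).2, fun s t => Iff.rfl⟩

variable {ι κ : Type} {D : ι → ASD} {E : κ → ASD}

theorem reducibleTo_directProduct_iff [Finite ι] [Finite κ] :
    (directProduct D).ReducibleTo (directProduct E) ↔
      ∃ φ : (∀ i, (D i).State) → ∀ j, (E j).State, ∀ π : ∀ i, (D i).parts,
        ∃ σ : ∀ j, (E j).parts,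
          Setoid.comap φ (prodPartition fun j => (σ j).1) ≤ prodPartition fun i => (π i).1 := by
  constructor
  · rintro ⟨φ, α, h⟩
    refine ⟨φ, fun π => ?_⟩
    let ρ : (directProduct D).parts := ⟨_, mem_parts_directProduct.2 ⟨π, rfl⟩⟩
    obtain ⟨σ, hσ⟩ := mem_parts_directProduct.1 (α ρ).2
    exact ⟨σ, hσ ▸ h ρ⟩
  · rintro ⟨φ, h⟩
    choose α hα using h
    choose π hπ using fun ρ : (directProduct D).parts => mem_parts_directProduct.1 ρ.2
    exact ⟨φ, fun ρ => ⟨_, mem_parts_directProduct.2 ⟨α (π ρ), rfl⟩⟩,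
      fun ρ => (hα (π ρ)).trans (hπ ρ).le⟩

theorem directProduct_reducibleTo_comp [Finite ι] [Finite κ] (D : ι → ASD) {e : κ → ι}
    (he : Function.Surjective e) :
    (directProduct D).ReducibleTo (directProduct fun j => D (e j)) :=
  reducibleTo_directProduct_iff.2 ⟨fun s j => s (e j), fun π => ⟨fun j => π (e j),
    fun _ _ hst => he.forall.2 hst⟩⟩

theorem directProduct_equivalent_comp_equiv [Finite ι] [Finite κ] (D : ι → ASD) (e : κ ≃ ι) :
    (directProduct D).Equivalent (directProduct fun j => D (e j)) := by
  refine ⟨directProduct_reducibleTo_comp D e.surjective, ?_⟩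
  simpa only [Equiv.apply_symm_apply] using
    directProduct_reducibleTo_comp (fun j => D (e j)) e.symm.surjective

variable [Fintype ι] [Fintype κ]

theorem numBlocks_prodPartition_nontrivialParts (hD : ∀ i, (D i).IsBinary)
    (p : ∀ i, (D i).nontrivialParts) :
    numBlocks (prodPartition fun i => (p i).1) = 2 ^ Fintype.card ι :=
  (numBlocks_prodPartition_eq_two_pow_iff fun i => hD i _ (p i).2.1).2
    fun i => ((hD i).mem_nontrivialParts_iff.1 (p i).2).2

theorem ReducibleTo.card_le (hD : ∀ i, (D i).IsBinary) (hE : ∀ j, (E j).IsBinary)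
    (hne : ∀ i, (D i).nontrivialParts.Nonempty)
    (h : (directProduct D).ReducibleTo (directProduct E)) :
    Fintype.card ι ≤ Fintype.card κ := by
  obtain ⟨φ, hφ⟩ := reducibleTo_directProduct_iff.1 h
  let p (i : ι) : (D i).nontrivialParts := ⟨_, (hne i).some_mem⟩
  obtain ⟨σ, hσ⟩ := hφ fun i => ⟨(p i).1, (p i).2.1⟩
  refine (Nat.pow_le_pow_iff_right one_lt_two).1 ?_
  calc 2 ^ Fintype.card ι = numBlocks (prodPartition fun i => (p i).1) :=
        (numBlocks_prodPartition_nontrivialParts hD p).symm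
    _ ≤ numBlocks (prodPartition fun j => (σ j).1) := numBlocks_le_of_comap_le hσ
    _ ≤ 2 ^ Fintype.card κ := numBlocks_prodPartition_le fun j => hE j _ (σ j).2

theorem ReducibleTo.exists_comap_eq (hD : ∀ i, (D i).IsBinary) (hE : ∀ j, (E j).IsBinary)
    (hcard : Fintype.card κ ≤ Fintype.card ι)
    (h : (directProduct D).ReducibleTo (directProduct E)) :
    ∃ φ : (∀ i, (D i).State) → ∀ j, (E j).State, ∀ p : ∀ i, (D i).nontrivialParts,
      ∃ q : ∀ j, (E j).nontrivialParts,
        Setoid.comap φ (prodPartition fun j => (q j).1) = prodPartition fun i => (p i).1 := by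
  obtain ⟨φ, hφ⟩ := reducibleTo_directProduct_iff.1 h
  refine ⟨φ, fun p => ?_⟩
  obtain ⟨σ, hσ⟩ := hφ fun i => ⟨(p i).1, (p i).2.1⟩
  have hσ_le_two (j : κ) : numBlocks (σ j).1 ≤ 2 := hE j _ (σ j).2
  have hpow : 2 ^ Fintype.card κ ≤ numBlocks (prodPartition fun i => (p i).1) :=
    (Nat.pow_le_pow_right two_pos hcard).trans_eq
      (numBlocks_prodPartition_nontrivialParts hD p).symm
  have hσ_le := numBlocks_prodPartition_le hσ_le_two
  have hσ_two := (numBlocks_prodPartition_eq_two_pow_iff hσ_le_two).1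
    (hσ_le.antisymm (hpow.trans (numBlocks_le_of_comap_le hσ)))
  exact ⟨fun j => ⟨σ j, (hE j).mem_nontrivialParts_iff.2 ⟨(σ j).2, hσ_two j⟩⟩,
    comap_eq_of_comap_le hσ (hσ_le.trans hpow)⟩

theorem numBlocks_prodPartition_sup_nontrivialParts (hD : ∀ i, (D i).IsBinary)
    (p q : ∀ i, (D i).nontrivialParts) :
    numBlocks ((prodPartition fun i => (p i).1) ⊔ prodPartition fun i => (q i).1) =
      2 ^ agreement p q := by
  rw [← agreement_coe]
  exact numBlocks_prodPartition_sup (fun i => ((hD i).mem_nontrivialParts_iff.1 (p i).2).2)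
    fun i => ((hD i).mem_nontrivialParts_iff.1 (q i).2).2

theorem ReducibleTo.exists_agreement_le (hD : ∀ i, (D i).IsBinary) (hE : ∀ j, (E j).IsBinary)
    (hcard : Fintype.card ι = Fintype.card κ)
    (h : (directProduct D).ReducibleTo (directProduct E)) :
    ∃ A : (∀ i, (D i).nontrivialParts) → ∀ j, (E j).nontrivialParts,
      ∀ p q, agreement (A p) (A q) ≤ agreement p q := by
  obtain ⟨φ, hφ⟩ := h.exists_comap_eq hD hE hcard.ge
  choose A hA using hφ
  refine ⟨A, fun p q => (Nat.pow_le_pow_iff_right one_lt_two).1 ?_⟩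
  rw [← numBlocks_prodPartition_sup_nontrivialParts hE,
    ← numBlocks_prodPartition_sup_nontrivialParts hD, ← hA p, ← hA q]
  refine numBlocks_sup_le_of_numBlocks_le_comap (le_of_eq ?_)
  rw [hA, numBlocks_prodPartition_nontrivialParts hD, numBlocks_prodPartition_nontrivialParts hE,
    hcard]

theorem Equivalent.map_ncard_nontrivialParts_eq (hD : ∀ i, (D i).IsBinary)
    (hE : ∀ j, (E j).IsBinary) (hDne : ∀ i, (D i).nontrivialParts.Nonempty)
    (hEne : ∀ j, (E j).nontrivialParts.Nonempty)
    (h : (directProduct D).Equivalent (directProduct E)) :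
    Finset.univ.val.map (fun i => (D i).nontrivialParts.ncard) =
      Finset.univ.val.map (fun j => (E j).nontrivialParts.ncard) := by
  have hcard := le_antisymm (h.1.card_le hD hE hDne) (h.2.card_le hE hD hEne)
  obtain ⟨A, hA⟩ := h.1.exists_agreement_le hD hE hcard
  obtain ⟨B, hB⟩ := h.2.exists_agreement_le hE hD hcard.symm
  have := fun i => (hDne i).to_subtype
  have := fun j => (hEne j).to_subtype
  exact map_card_eq_of_agreement_le hcard hA hB

end BinaryDevices

/-! ### Binary linear devices -/

section LinearDevices

theorem isBinary_L (n : ℕ) : (L n).IsBinary := by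
  rintro _ ⟨f, rfl⟩
  have hcard : Nat.card (Fin 1 → ZMod 2) = 2 := by
    rw [Nat.card_fun, Nat.card_zmod, Nat.card_fin, pow_one]
  exact (numBlocks_ker_le f).trans_eq hcard

theorem ker_injective_of_zmod_two {V : Type*} [AddCommGroup V] [Module (ZMod 2) V] :
    Function.Injective fun f : V →ₗ[ZMod 2] (Fin 1 → ZMod 2) => Setoid.ker f := by
  have eq_of_eq_zero_iff : ∀ a b : Fin 1 → ZMod 2, (a = 0 ↔ b = 0) → a = b := by decide
  intro f g h
  ext1 v
  refine eq_of_eq_zero_iff _ _ ?_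
  simpa only [Setoid.ker_def, map_zero] using iff_of_eq (congrArg (fun π : Setoid V => π v 0) h)

theorem ncard_parts_L (n : ℕ) : (L n).parts.ncard = 2 ^ n := by
  have hcard : Nat.card ((Fin n → ZMod 2) →ₗ[ZMod 2] (Fin 1 → ZMod 2)) = 2 ^ n := by
    rw [Module.natCard_eq_pow_finrank (K := ZMod 2), Nat.card_zmod, Module.finrank_linearMap,
      Module.finrank_fin_fun, Module.finrank_fin_fun, mul_one]
  rw [← hcard]
  exact Set.ncard_range_of_injective ker_injective_of_zmod_two

theorem ncard_nontrivialParts_L (n : ℕ) : (L n).nontrivialParts.ncard = 2 ^ n - 1 := by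
  have htop : ⊤ ∈ (L n).parts := ⟨0, Setoid.eq_top_iff.2 fun _ _ => rfl⟩
  rw [nontrivialParts, Set.ncard_sdiff_singleton_of_mem htop, ncard_parts_L]

theorem nontrivialParts_L_nonempty {n : ℕ} (hn : 1 ≤ n) : (L n).nontrivialParts.Nonempty := by
  refine Set.nonempty_of_ncard_ne_zero ?_
  rw [ncard_nontrivialParts_L]
  exact Nat.sub_ne_zero_of_lt (Nat.one_lt_two_pow (Nat.one_le_iff_ne_zero.1 hn))

theorem map_eq_of_directProduct_L_equivalent {ι κ : Type} [Fintype ι] [Fintype κ] {k : ι → ℕ}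
    {r : κ → ℕ} (hk : ∀ i, 1 ≤ k i) (hr : ∀ j, 1 ≤ r j)
    (h : (directProduct fun i => L (k i)).Equivalent (directProduct fun j => L (r j))) :
    Finset.univ.val.map k = Finset.univ.val.map r := by
  have hcount := h.map_ncard_nontrivialParts_eq (fun i => isBinary_L (k i))
    (fun j => isBinary_L (r j)) (fun i => nontrivialParts_L_nonempty (hk i))
    fun j => nontrivialParts_L_nonempty (hr j)
  have hlog (n : ℕ) : Nat.log 2 (2 ^ n - 1 + 1) = n := by
    rw [Nat.sub_add_cancel Nat.one_le_two_pow, Nat.log_pow one_lt_two]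
  simpa only [ncard_nontrivialParts_L, Multiset.map_map, Function.comp_def, hlog] using
    congrArg (Multiset.map fun c => Nat.log 2 (c + 1)) hcount

end LinearDevices

end ASD

theorem mainTheorem7 (m n : ℕ) (k : Fin m → ℕ) (r : Fin n → ℕ)
    (hk : ∀ i, 1 ≤ k i) (hr : ∀ j, 1 ≤ r j) :
    (ASD.directProduct fun i => ASD.L (k i)).Equivalent
        (ASD.directProduct fun j => ASD.L (r j)) ↔
      Finset.univ.val.map (fun i => ASD.L (k i)) =
        Finset.univ.val.map (fun j => ASD.L (r j)) := by
  constructor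
  · intro h
    simpa only [Multiset.map_map, Function.comp_def] using
      congrArg (Multiset.map ASD.L) (ASD.map_eq_of_directProduct_L_equivalent hk hr h)
  · intro h
    obtain ⟨e, he⟩ := ASD.exists_equiv_of_map_univ_eq h
    simpa only [he] using ASD.directProduct_equivalent_comp_equiv (fun i => ASD.L (k i)) e
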